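/- Let $K$ be a field of characteristic zero; all spaces, maps and tensor products are over $K$, and $\tau(u\otimes v)=v\otimes u$. An *alternative bialgebra* is a vector space $M$ with a bilinear multiplication and a linear comultiplication $\Delta(a)=\sum a_1\otimes a_2$ such that * the associator $(a,b,c)=(ab)c-a(bc)$ satisfies $(a,b,c)=-(b,a,c)$ and $(a,b,c)=-(a,c,b)$; * the map $D=(\Delta\otimes\mathrm{id})\Delta-(\mathrm{id}\otimes\Delta)\Delta$ satisfies $D=-\tau_{12}D$ and $D=-\tau_{23}D$, where $\tau_{12}$ and $\tau_{23}$ exchange the first two and the last two tensor factors; * $\Delta(ab)=\sum(a_1b\otimes a_2+a_2b\otimes a_1-a_2\otimes ba_1)+\sum(b_1\otimes ab_2+b_1\otimes b_2a-ab_1\otimes b_2)$; * $\Delta(ba)+\tau\Delta(ba)=\sum(a_1\otimes ba_2+ba_2\otimes a_1)+\sum(b_1a\otimes b_2+b_2\otimes b_1a)$. Homomorphisms are the linear maps that preserve multiplication and comultiplication. Let $E$ be a vector space, $A\subseteq E$ a subspace with an alternative bialgebra structure $(A,\cdot,\Delta_A)$, and $V$ a complement of $A$ in $E$. Write elements of $E=A\oplus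 V$ as $a+x$ with $a\in A$, $x\in V$; let $i:A\to E$ be the inclusion and $p:E\to A$, $p(a+x)=a$. $\mathcal{IB}^{(1)}(A,V)$ is the set of tuples of linear maps $\Omega^{(1)}=(\triangleright,\triangleleft,\phi,\psi,\rho,\gamma,\theta,P,\cdot_V,\Delta_V)$, $$\triangleright:A\otimes V\to V,\quad \triangleleft:V\otimes A\to V,\quad \theta:A\otimes A\to V,\quad \cdot_V:V\otimes V\to V,\quad \phi:A\to V\otimes A,$$ $$\psi:A\to A\otimes V,\quad P:A\to V\otimes V,\quad \Delta_V:V\to V\otimes V,\quad \rho:V\to A\otimes V,\quad \gamma:V\to V\otimes A,$$ for which $E$ with $$(a+x)(b+y)=ab+\big(xy+a\triangleright y+x\triangleleft b+\theta(a,b)\big),$$ $$\Delta_E(a)=\Delta_A(a)+\phi(a)+\psi(a)+P(a),\qquad \Delta_E(x)=\Delta_V(x)+\rho(x)+\gamma(x)$$ is an alternative bialgebra, denoted $A^{P}\#_{\theta}V$ (extending data of type (I)). $\mathcal{IB}^{(2)}(A,V)$ is the set of tuples of linear maps $\Omega^{(2)}=(\rightharpoonup,\leftharpoonup,\triangleright,\triangleleft,\sigma,\rho,\gamma,Q,\cdot_V,\Delta_V)$,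 with $\triangleright,\triangleleft,\rho,\gamma,\cdot_V,\Delta_V$ between the same spaces as above and $$\rightharpoonup:V\otimes A\to A,\quad \leftharpoonup:A\otimes V\to A,\quad \sigma:V\otimes V\to A,\quad Q:V\to A\otimes A,$$ for which $E$ with $$(a+x)(b+y)=\big(ab+x\rightharpoonup b+a\leftharpoonup y+\sigma(x,y)\big)+\big(xy+x\triangleleft b+a\triangleright y\big),$$ $$\Delta_E(a)=\Delta_A(a),\qquad \Delta_E(x)=\Delta_V(x)+\rho(x)+\gamma(x)+Q(x)$$ is an alternative bialgebra, denoted $A_{\sigma}\#^{Q}V$ (extending data of type (II)). On the disjoint union $\mathcal{IB}^{(1)}(A,V)\sqcup\mathcal{IB}^{(2)}(A,V)$ let $\Omega\equiv\Omega'$ if there are linear maps $r:V\to A$ and $s:V\to V$ such that $\varphi_{r,s}:E\to E$, $\varphi_{r,s}(a+x)=(a+r(x))+s(x)$, is an isomorphism from the alternative bialgebra of $\Omega$ to that of $\Omega'$. This is an equivalence relation; put $$\mathcal{HLB}(V,A)=\big(\mathcal{IB}^{(1)}(A,V)\sqcup\mathcal{IB}^{(2)}(A,V)\big)/\equiv .$$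 Let $BExtd(E,A)$ be the set of extending systems of $A$ through $V$ on $E$, that is, of the alternative bialgebra structures on $E$ for which $i:A\to E$ or $p:E\to A$ is a homomorphism of alternative bialgebras, modulo isomorphisms $\varphi:E\to E$ of such structures that stabilize $A$ (i.e. $\varphi(a)=a$ for all $a\in A$). **Theorem.** The structures $A^{P}\#_{\theta}V$ and $A_{\sigma}\#^{Q}V$ are extending systems of $A$ through $V$ on $E$, and the map $$\Upsilon:\mathcal{HLB}(V,A)\to BExtd(E,A),\qquad \overline{\Omega^{(1)}}\mapsto A^{P}\#_{\theta}V,\qquad \overline{\Omega^{(2)}}\mapsto A_{\sigma}\#^{Q}V,$$ is well defined and bijective. -/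

import Mathlib

open scoped TensorProduct

noncomputable section

namespace AltExt

universe u v w

/-- A vector space equipped with a multiplication and a comultiplication (no axioms). -/
@[ext]
structure BialgStr (K : Type u) (M : Type v) [Field K] [AddCommGroup M] [Module K M] where
  mul : M →ₗ[K] M →ₗ[K] M
  comul : M →ₗ[K] M ⊗[K] M

/-- The associator `(a, b, c) = (ab)c - a(bc)` of a multiplication. -/
def associator {K : Type u} {M : Type v} [Field K] [AddCommGroup M] [Module K M]
    (mul : M →ₗ[K] M →ₗ[K] M) (a b c : M) : M :=
  mul (mul a b) c - mul a (mul b c)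

/-- Alternative algebra: the associator is skew in its first two and in its last two arguments. -/
structure IsAlternativeAlgebra {K : Type u} {M : Type v} [Field K] [AddCommGroup M] [Module K M]
    (mul : M →ₗ[K] M →ₗ[K] M) : Prop where
  skew_left : ∀ a b c, associator mul a b c = -associator mul b a c
  skew_right : ∀ a b c, associator mul a b c = -associator mul a c b

/-- The map `(Δ ⊗ id) Δ - (id ⊗ Δ) Δ`, with `M ⊗ M ⊗ M` bracketed to the right. -/
def coassociator {K : Type u} {M : Type v} [Field K] [AddCommGroup M] [Module K M]
    (comul : M →ₗ[K] M ⊗[K] M) : M →ₗ[K] M ⊗[K] (M ⊗[K] M) :=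
  (TensorProduct.assoc K M M M).toLinearMap ∘ₗ comul.rTensor M ∘ₗ comul
    - comul.lTensor M ∘ₗ comul

/-- `τ₁₂ (a ⊗ b ⊗ c) = b ⊗ a ⊗ c`. -/
def tau12 (K : Type u) (M : Type v) [Field K] [AddCommGroup M] [Module K M] :
    M ⊗[K] (M ⊗[K] M) →ₗ[K] M ⊗[K] (M ⊗[K] M) :=
  (TensorProduct.leftComm K M M M).toLinearMap

/-- `τ₂₃ (a ⊗ b ⊗ c) = a ⊗ c ⊗ b`. -/
def tau23 (K : Type u) (M : Type v) [Field K] [AddCommGroup M] [Module K M] :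
    M ⊗[K] (M ⊗[K] M) →ₗ[K] M ⊗[K] (M ⊗[K] M) :=
  (TensorProduct.comm K M M).toLinearMap.lTensor M

/-- Alternative coalgebra. -/
structure IsAlternativeCoalgebra {K : Type u} {M : Type v} [Field K] [AddCommGroup M] [Module K M]
    (comul : M →ₗ[K] M ⊗[K] M) : Prop where
  skew_left : ∀ a, coassociator comul a = -tau12 K M (coassociator comul a)
  skew_right : ∀ a, coassociator comul a = -tau23 K M (coassociator comul a)

/-- The flip `τ (u ⊗ v) = v ⊗ u`. -/
def flip (K : Type u) (M : Type v) [Field K] [AddCommGroup M] [Module K M] :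
    M ⊗[K] M →ₗ[K] M ⊗[K] M :=
  (TensorProduct.comm K M M).toLinearMap

namespace BialgStr

variable {K : Type u} {M : Type v} [Field K] [AddCommGroup M] [Module K M]

/-- `u ⊗ v ↦ a u ⊗ v`. -/
def mulLeftFst (S : BialgStr K M) (a : M) : M ⊗[K] M →ₗ[K] M ⊗[K] M := (S.mul a).rTensor M

/-- `u ⊗ v ↦ u a ⊗ v`. -/
def mulRightFst (S : BialgStr K M) (a : M) : M ⊗[K] M →ₗ[K] M ⊗[K] M := (S.mul.flip a).rTensor M

/-- `u ⊗ v ↦ u ⊗ a v`. -/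
def mulLeftSnd (S : BialgStr K M) (a : M) : M ⊗[K] M →ₗ[K] M ⊗[K] M := (S.mul a).lTensor M

/-- `u ⊗ v ↦ u ⊗ v a`. -/
def mulRightSnd (S : BialgStr K M) (a : M) : M ⊗[K] M →ₗ[K] M ⊗[K] M := (S.mul.flip a).lTensor M

/-- Alternative bialgebra. In Sweedler notation the two compatibility conditions read
`Δ(ab) = a₁b ⊗ a₂ + a₂b ⊗ a₁ - a₂ ⊗ ba₁ + b₁ ⊗ ab₂ + b₁ ⊗ b₂a - ab₁ ⊗ b₂` and
`Δ(ba) + τΔ(ba) = a₁ ⊗ ba₂ + ba₂ ⊗ a₁ + b₁a ⊗ b₂ + b₂ ⊗ b₁a`. -/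
structure IsAlternativeBialgebra (S : BialgStr K M) : Prop where
  algebra : IsAlternativeAlgebra S.mul
  coalgebra : IsAlternativeCoalgebra S.comul
  comul_mul : ∀ a b,
    S.comul (S.mul a b) =
      S.mulRightFst b (S.comul a) + S.mulRightFst b (flip K M (S.comul a))
        - S.mulLeftSnd b (flip K M (S.comul a))
        + S.mulLeftSnd a (S.comul b) + S.mulRightSnd a (S.comul b) - S.mulLeftFst a (S.comul b)
  comul_mul_symm : ∀ a b,
    S.comul (S.mul b a) + flip K M (S.comul (S.mul b a)) =
      S.mulLeftSnd b (S.comul a) + S.mulLeftFst b (flip K M (S.comul a))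
        + S.mulRightFst a (S.comul b) + S.mulRightSnd a (flip K M (S.comul b))

/-- `f` is a homomorphism both of algebras and of coalgebras. -/
structure IsHom {N : Type w} [AddCommGroup N] [Module K N] (S : BialgStr K M) (T : BialgStr K N)
    (f : M →ₗ[K] N) : Prop where
  map_mul : ∀ a b, f (S.mul a b) = T.mul (f a) (f b)
  map_comul : ∀ a, T.comul (f a) = TensorProduct.map f f (S.comul a)

theorem IsHom.id (S : BialgStr K M) : IsHom S S LinearMap.id :=
  ⟨fun _ _ => rfl, fun a => by simp⟩

theorem IsHom.comp {N : Type*} [AddCommGroup N] [Module K N] {L : Type*} [AddCommGroup L]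
    [Module K L] {S : BialgStr K M} {T : BialgStr K N} {U : BialgStr K L}
    {g : N →ₗ[K] L} {f : M →ₗ[K] N} (hg : IsHom T U g) (hf : IsHom S T f) :
    IsHom S U (g ∘ₗ f) :=
  ⟨fun a b => by simp [hf.map_mul, hg.map_mul],
   fun a => by simp [hg.map_comul, hf.map_comul, TensorProduct.map_comp]⟩

theorem IsHom.symm {N : Type*} [AddCommGroup N] [Module K N]
    {S : BialgStr K M} {T : BialgStr K N} {e : M ≃ₗ[K] N}
    (he : IsHom S T e.toLinearMap) : IsHom T S e.symm.toLinearMap :=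
  ⟨fun a b => e.injective (by
      have := he.map_mul (e.symm a) (e.symm b)
      simpa using this.symm),
   fun a => by
      have := he.map_comul (e.symm a)
      simp only [LinearEquiv.coe_coe, LinearEquiv.apply_symm_apply] at this
      rw [LinearEquiv.coe_coe, this, ← LinearMap.comp_apply (TensorProduct.map _ _),
        ← TensorProduct.map_comp]
      simp⟩

end BialgStr

/-- An alternative bialgebra structure on `M`. -/
abbrev AltBialgebra (K : Type u) (M : Type v) [Field K] [AddCommGroup M] [Module K M] :=
  {S : BialgStr K M // S.IsAlternativeBialgebra}

/-- The linear maps of an extending datum of type (I) of `A` by `V`; `lact` and `ract` are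
`▷ : A ⊗ V → V` and `◁ : V ⊗ A → V`. -/
structure PreDatumI (K : Type u) (A : Type v) (V : Type w) [Field K] [AddCommGroup A] [Module K A]
    [AddCommGroup V] [Module K V] where
  lact : A →ₗ[K] V →ₗ[K] V
  ract : V →ₗ[K] A →ₗ[K] V
  φ : A →ₗ[K] V ⊗[K] A
  ψ : A →ₗ[K] A ⊗[K] V
  ρ : V →ₗ[K] A ⊗[K] V
  γ : V →ₗ[K] V ⊗[K] A
  θ : A →ₗ[K] A →ₗ[K] V
  P : A →ₗ[K] V ⊗[K] V
  mulV : V →ₗ[K] V →ₗ[K] V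
  comulV : V →ₗ[K] V ⊗[K] V

/-- The linear maps of an extending datum of type (II) of `A` by `V`; `lharp` and `rharp` are
`⇀ : V ⊗ A → A` and `↼ : A ⊗ V → A`, and `lact` and `ract` are
`▷ : A ⊗ V → V` and `◁ : V ⊗ A → V`. -/
structure PreDatumII (K : Type u) (A : Type v) (V : Type w) [Field K] [AddCommGroup A] [Module K A]
    [AddCommGroup V] [Module K V] where
  lharp : V →ₗ[K] A →ₗ[K] A
  rharp : A →ₗ[K] V →ₗ[K] A
  lact : A →ₗ[K] V →ₗ[K] V
  ract : V →ₗ[K] A →ₗ[K] V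
  σ : V →ₗ[K] V →ₗ[K] A
  ρ : V →ₗ[K] A ⊗[K] V
  γ : V →ₗ[K] V ⊗[K] A
  Q : V →ₗ[K] A ⊗[K] A
  mulV : V →ₗ[K] V →ₗ[K] V
  comulV : V →ₗ[K] V ⊗[K] V

section Extending

variable {K : Type u} {E : Type v} [Field K] [AddCommGroup E] [Module K E] {A V : Submodule K E}

/-- The projection `p : E → A`, `a + x ↦ a`. -/
abbrev projA (h : IsCompl A V) : E →ₗ[K] A := A.projectionOnto V h

/-- The projection `π : E → V`, `a + x ↦ x`. -/
abbrev projV (h : IsCompl A V) : E →ₗ[K] V := V.projectionOnto A h.symm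

/-- The unified product and coproduct of type (I) on `E = A ⊕ V`:
`(a + x)(b + y) = ab + (xy + a ▷ y + x ◁ b + θ(a, b))` and
`Δ(a + x) = Δ_A(a) + φ(a) + ψ(a) + P(a) + Δ_V(x) + ρ(x) + γ(x)`. -/
def unifiedI (B : BialgStr K A) (h : IsCompl A V) (Ω : PreDatumI K A V) : BialgStr K E where
  mul := (B.mul.compl₁₂ (projA h) (projA h)).compr₂ A.subtype
    + (Ω.mulV.compl₁₂ (projV h) (projV h)
        + Ω.lact.compl₁₂ (projA h) (projV h)
        + Ω.ract.compl₁₂ (projV h) (projA h)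
        + Ω.θ.compl₁₂ (projA h) (projA h)).compr₂ V.subtype
  comul := (TensorProduct.map A.subtype A.subtype ∘ₗ B.comul
        + TensorProduct.map V.subtype A.subtype ∘ₗ Ω.φ
        + TensorProduct.map A.subtype V.subtype ∘ₗ Ω.ψ
        + TensorProduct.map V.subtype V.subtype ∘ₗ Ω.P) ∘ₗ projA h
    + (TensorProduct.map V.subtype V.subtype ∘ₗ Ω.comulV
        + TensorProduct.map A.subtype V.subtype ∘ₗ Ω.ρ
        + TensorProduct.map V.subtype A.subtype ∘ₗ Ω.γ) ∘ₗ projV h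

/-- The unified product and coproduct of type (II) on `E = A ⊕ V`:
`(a + x)(b + y) = (ab + x ⇀ b + a ↼ y + σ(x, y)) + (xy + x ◁ b + a ▷ y)` and
`Δ(a + x) = Δ_A(a) + Δ_V(x) + ρ(x) + γ(x) + Q(x)`. -/
def unifiedII (B : BialgStr K A) (h : IsCompl A V) (Ω : PreDatumII K A V) : BialgStr K E where
  mul := (B.mul.compl₁₂ (projA h) (projA h)
        + Ω.lharp.compl₁₂ (projV h) (projA h)
        + Ω.rharp.compl₁₂ (projA h) (projV h)
        + Ω.σ.compl₁₂ (projV h) (projV h)).compr₂ A.subtype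
    + (Ω.mulV.compl₁₂ (projV h) (projV h)
        + Ω.ract.compl₁₂ (projV h) (projA h)
        + Ω.lact.compl₁₂ (projA h) (projV h)).compr₂ V.subtype
  comul := (TensorProduct.map A.subtype A.subtype ∘ₗ B.comul) ∘ₗ projA h
    + (TensorProduct.map V.subtype V.subtype ∘ₗ Ω.comulV
        + TensorProduct.map A.subtype V.subtype ∘ₗ Ω.ρ
        + TensorProduct.map V.subtype A.subtype ∘ₗ Ω.γ
        + TensorProduct.map A.subtype A.subtype ∘ₗ Ω.Q) ∘ₗ projV h

/-- The set `IB⁽¹⁾(A, V)` of alternative bialgebraic extending data of type (I). -/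
abbrev DatumI (B : BialgStr K A) (h : IsCompl A V) :=
  {Ω : PreDatumI K A V // (unifiedI B h Ω).IsAlternativeBialgebra}

/-- The set `IB⁽²⁾(A, V)` of alternative bialgebraic extending data of type (II). -/
abbrev DatumII (B : BialgStr K A) (h : IsCompl A V) :=
  {Ω : PreDatumII K A V // (unifiedII B h Ω).IsAlternativeBialgebra}

/-- The unified bialgebra on `E` of an element of the disjoint union `IB⁽¹⁾ ⊔ IB⁽²⁾`. -/
def unified (B : BialgStr K A) (h : IsCompl A V) : DatumI B h ⊕ DatumII B h → BialgStr K E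
  | .inl Ω => unifiedI B h Ω.1
  | .inr Ω => unifiedII B h Ω.1

/-- `φ_{r,s}(a + x) = (a + r(x)) + s(x)`. -/
def phi (h : IsCompl A V) (r : V →ₗ[K] A) (s : V →ₗ[K] V) : E →ₗ[K] E :=
  A.subtype ∘ₗ (projA h + r ∘ₗ projV h) + V.subtype ∘ₗ s ∘ₗ projV h

/-- `Ω ≡ Ω'`: for some linear maps `r : V → A` and `s : V → V` the map `φ_{r,s}` is an isomorphism
between the unified bialgebras of `Ω` and `Ω'`. -/
def DatumEquiv (B : BialgStr K A) (h : IsCompl A V) (Ω Ω' : DatumI B h ⊕ DatumII B h) : Prop :=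
  ∃ (r : V →ₗ[K] A) (s : V →ₗ[K] V),
    Function.Bijective (phi h r s) ∧ (unified B h Ω).IsHom (unified B h Ω') (phi h r s)

theorem phi_apply_left (h : IsCompl A V) (r : V →ₗ[K] A) (s : V →ₗ[K] V) (a : A) :
    phi h r s a = a := by
  simp [phi]

theorem exists_eq_phi (h : IsCompl A V) (f : E →ₗ[K] E) (hf : ∀ a : A, f a = a) :
    ∃ (r : V →ₗ[K] A) (s : V →ₗ[K] V), f = phi h r s := by
  refine ⟨projA h ∘ₗ f ∘ₗ V.subtype, projV h ∘ₗ f ∘ₗ V.subtype, ?_⟩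
  ext e
  have h1 : ∀ e : E, (projA h e : E) + projV h e = e := fun e => by
    simpa [Submodule.coe_projectionOnto_apply] using
      Submodule.projection_add_projection_eq_self h e
  have h2 : f e = projA h e + f (projV h e) := by
    conv_lhs => rw [← h1 e, map_add, hf]
  rw [h2]
  conv_lhs => rw [← h1 (f (projV h e))]
  simp [phi, add_assoc]

/-- `≡` is an equivalence relation on the disjoint union `IB⁽¹⁾ ⊔ IB⁽²⁾`. -/
def datumSetoid (B : BialgStr K A) (h : IsCompl A V) : Setoid (DatumI B h ⊕ DatumII B h) where
  r := DatumEquiv B h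
  iseqv := by
    refine ⟨fun Ω => ?_, ?_, ?_⟩
    · obtain ⟨r, s, hrs⟩ := exists_eq_phi h LinearMap.id (fun _ => rfl)
      exact ⟨r, s, hrs ▸ Function.bijective_id, hrs ▸ BialgStr.IsHom.id _⟩
    · rintro Ω Ω' ⟨r, s, hb, hh⟩
      let e := LinearEquiv.ofBijective (phi h r s) hb
      obtain ⟨r', s', hrs⟩ := exists_eq_phi h e.symm.toLinearMap (fun a => by
        rw [LinearEquiv.coe_coe, LinearEquiv.symm_apply_eq]
        exact (phi_apply_left h r s a).symm)
      refine ⟨r', s', hrs ▸ e.symm.bijective, hrs ▸ ?_⟩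
      exact BialgStr.IsHom.symm (e := e) hh
    · rintro Ω Ω' Ω'' ⟨r, s, hb, hh⟩ ⟨r', s', hb', hh'⟩
      obtain ⟨r'', s'', hrs⟩ := exists_eq_phi h (phi h r' s' ∘ₗ phi h r s) (fun a => by
        simp [phi_apply_left])
      refine ⟨r'', s'', ?_, ?_⟩
      · rw [← hrs]; exact hb'.comp hb
      · rw [← hrs]; exact hh'.comp hh

/-- `HLB(V, A) = (IB⁽¹⁾(A, V) ⊔ IB⁽²⁾(A, V)) / ≡`. -/
abbrev HLB (B : BialgStr K A) (h : IsCompl A V) := Quotient (datumSetoid B h)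

/-- `S` is an extending system of `A` through `V` on `E`: an alternative bialgebra structure for
which the inclusion `A → E` or the projection `E → A` along `V` is a bialgebra homomorphism. -/
structure IsExtendingSystem (B : BialgStr K A) (h : IsCompl A V) (S : BialgStr K E) : Prop where
  isAlternativeBialgebra : S.IsAlternativeBialgebra
  isHom : B.IsHom S A.subtype ∨ S.IsHom B (projA h)

/-- Isomorphism of structures on `E` by a map that stabilizes `A`. -/
def extSetoid (B : BialgStr K A) (h : IsCompl A V) :
    Setoid {S : BialgStr K E // IsExtendingSystem B h S} where
  r S T := ∃ e : E ≃ₗ[K] E, S.1.IsHom T.1 e.toLinearMap ∧ ∀ a : A, e a = a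
  iseqv := by
    refine ⟨fun S => ⟨LinearEquiv.refl K E, BialgStr.IsHom.id _, fun _ => rfl⟩, ?_, ?_⟩
    · rintro S T ⟨e, he, ha⟩
      exact ⟨e.symm, he.symm, fun a => by rw [LinearEquiv.symm_apply_eq, ha]⟩
    · rintro S T U ⟨e, he, ha⟩ ⟨f, hf, hb⟩
      exact ⟨e.trans f, hf.comp he, fun a => by simp [ha, hb]⟩

/-- `BExtd(E, A)`. -/
abbrev BExtd (B : BialgStr K A) (h : IsCompl A V) := Quotient (extSetoid B h)

end Extending

end AltExt

end

/-!
The unified structures of type (I) are precisely the alternative bialgebra structures on `E` for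
which the projection `p : E → A` is a homomorphism, and those of type (II) precisely the ones for
which the inclusion `i : A → E` is a homomorphism. For this, decompose `E = A ⊕ V` and
`E ⊗ E = (A ⊗ A) ⊕ (V ⊗ A) ⊕ (A ⊗ V) ⊕ (V ⊗ V)`, and list the components of an arbitrary
multiplication and comultiplication. If `p` is a homomorphism, the component of the multiplication
in `A` and that of the comultiplication in `A ⊗ A` are determined by `A`, and the remaining
components are an extending datum of type (I) (`exists_unifiedI_eq`). If `i` is a homomorphism,
everything is determined on `A`, and the remaining components are an extending datum of type (II)
(`exists_unifiedII_eq`).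

Since `φ_{r,s}` fixes `A` pointwise and every linear endomorphism of `E` that fixes `A` pointwise is
some `φ_{r,s}`, two data are equivalent if and only if their unified bialgebras are isomorphic by a
map stabilizing `A` (`datumEquiv_iff`). So `Ω ↦ unified B h Ω` descends to a well-defined injective
map on equivalence classes, which is surjective by the two existence results.
-/

open scoped TensorProduct

noncomputable section

namespace AltExt

section UnifiedStructures

variable {K : Type*} {E : Type*} [Field K] [AddCommGroup E] [Module K E] {A V : Submodule K E}

/-! ### Components along `E = A ⊕ V` -/

theorem coe_projA_add_coe_projV (h : IsCompl A V) (e : E) :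
    (projA h e : E) + (projV h e : E) = e := by
  simpa [Submodule.coe_projectionOnto_apply] using
    Submodule.projection_add_projection_eq_self h e

/-- The decomposition of `E ⊗ E` into its components in `A ⊗ A`, `V ⊗ A`, `A ⊗ V` and `V ⊗ V`. -/
theorem tensor_eq_sum_components (h : IsCompl A V) (t : E ⊗[K] E) :
    t = TensorProduct.map A.subtype A.subtype (TensorProduct.map (projA h) (projA h) t)
      + TensorProduct.map V.subtype A.subtype (TensorProduct.map (projV h) (projA h) t)
      + TensorProduct.map A.subtype V.subtype (TensorProduct.map (projA h) (projV h) t)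
      + TensorProduct.map V.subtype V.subtype (TensorProduct.map (projV h) (projV h) t) := by
  induction t using TensorProduct.induction_on with
  | zero => simp
  | tmul x y =>
    conv_lhs => rw [← coe_projA_add_coe_projV h x, ← coe_projA_add_coe_projV h y]
    simp only [TensorProduct.map_tmul, TensorProduct.add_tmul, TensorProduct.tmul_add,
      Submodule.subtype_apply]
    abel
  | add s t hs ht =>
    conv_lhs => rw [hs, ht]
    simp only [map_add]
    abel

theorem projA_comp_subtype (h : IsCompl A V) : projA h ∘ₗ A.subtype = LinearMap.id := by
  ext a; simp

theorem projA_comp_subtype_right (h : IsCompl A V) : projA h ∘ₗ V.subtype = 0 := by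
  ext x; simp

/-! ### Unified structures as extending systems -/

theorem unifiedI_isHom_projA (B : BialgStr K A) (h : IsCompl A V) (Ω : PreDatumI K A V) :
    (unifiedI B h Ω).IsHom B (projA h) where
  map_mul e f := by simp [unifiedI]
  map_comul e := by
    simp only [unifiedI, LinearMap.add_apply, LinearMap.comp_apply, map_add,
      TensorProduct.map_map, projA_comp_subtype, projA_comp_subtype_right,
      TensorProduct.map_zero_left, TensorProduct.map_zero_right, TensorProduct.map_id]
    simp

theorem unifiedII_isHom_subtype (B : BialgStr K A) (h : IsCompl A V) (Ω : PreDatumII K A V) :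
    B.IsHom (unifiedII B h Ω) A.subtype where
  map_mul a b := by simp [unifiedII]
  map_comul a := by simp [unifiedII]

theorem unified_isExtendingSystem (B : BialgStr K A) (h : IsCompl A V) :
    ∀ Ω : DatumI B h ⊕ DatumII B h, IsExtendingSystem B h (unified B h Ω)
  | .inl Ω => ⟨Ω.2, .inr (unifiedI_isHom_projA B h Ω.1)⟩
  | .inr Ω => ⟨Ω.2, .inl (unifiedII_isHom_subtype B h Ω.1)⟩

/-! ### Extending systems as unified structures -/

/-- A structure for which the projection `E → A` is a homomorphism is unified of type (I). -/
theorem exists_unifiedI_eq {B : BialgStr K A} {h : IsCompl A V} {S : BialgStr K E}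
    (hS : S.IsHom B (projA h)) : ∃ Ω : PreDatumI K A V, unifiedI B h Ω = S := by
  refine ⟨
    { lact := (S.mul.compl₁₂ A.subtype V.subtype).compr₂ (projV h)
      ract := (S.mul.compl₁₂ V.subtype A.subtype).compr₂ (projV h)
      φ := TensorProduct.map (projV h) (projA h) ∘ₗ S.comul ∘ₗ A.subtype
      ψ := TensorProduct.map (projA h) (projV h) ∘ₗ S.comul ∘ₗ A.subtype
      ρ := TensorProduct.map (projA h) (projV h) ∘ₗ S.comul ∘ₗ V.subtype
      γ := TensorProduct.map (projV h) (projA h) ∘ₗ S.comul ∘ₗ V.subtype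
      θ := (S.mul.compl₁₂ A.subtype A.subtype).compr₂ (projV h)
      P := TensorProduct.map (projV h) (projV h) ∘ₗ S.comul ∘ₗ A.subtype
      mulV := (S.mul.compl₁₂ V.subtype V.subtype).compr₂ (projV h)
      comulV := TensorProduct.map (projV h) (projV h) ∘ₗ S.comul ∘ₗ V.subtype }, ?_⟩
  apply BialgStr.ext
  · refine LinearMap.ext₂ fun e f => ?_
    have hV : projV h (S.mul e f) =
        projV h (S.mul (projA h e + projV h e) (projA h f + projV h f)) := by
      rw [coe_projA_add_coe_projV, coe_projA_add_coe_projV]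
    rw [← coe_projA_add_coe_projV h (S.mul e f), hS.map_mul, hV]
    simp only [unifiedI, LinearMap.add_apply, LinearMap.compr₂_apply, LinearMap.compl₁₂_apply,
      Submodule.subtype_apply, map_add, Submodule.coe_add]
    abel
  · refine LinearMap.ext fun e => ?_
    have hc : S.comul e = S.comul (projA h e) + S.comul (projV h e) := by
      rw [← map_add, coe_projA_add_coe_projV]
    rw [tensor_eq_sum_components h (S.comul e), ← hS.map_comul, hc]
    simp only [unifiedI, LinearMap.add_apply, LinearMap.comp_apply, Submodule.subtype_apply,
      map_add]
    abel

/-- A structure for which the inclusion `A → E` is a homomorphism is unified of type (II). -/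
theorem exists_unifiedII_eq {B : BialgStr K A} {S : BialgStr K E} (h : IsCompl A V)
    (hS : B.IsHom S A.subtype) : ∃ Ω : PreDatumII K A V, unifiedII B h Ω = S := by
  refine ⟨
    { lharp := (S.mul.compl₁₂ V.subtype A.subtype).compr₂ (projA h)
      rharp := (S.mul.compl₁₂ A.subtype V.subtype).compr₂ (projA h)
      lact := (S.mul.compl₁₂ A.subtype V.subtype).compr₂ (projV h)
      ract := (S.mul.compl₁₂ V.subtype A.subtype).compr₂ (projV h)
      σ := (S.mul.compl₁₂ V.subtype V.subtype).compr₂ (projA h)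
      ρ := TensorProduct.map (projA h) (projV h) ∘ₗ S.comul ∘ₗ V.subtype
      γ := TensorProduct.map (projV h) (projA h) ∘ₗ S.comul ∘ₗ V.subtype
      Q := TensorProduct.map (projA h) (projA h) ∘ₗ S.comul ∘ₗ V.subtype
      mulV := (S.mul.compl₁₂ V.subtype V.subtype).compr₂ (projV h)
      comulV := TensorProduct.map (projV h) (projV h) ∘ₗ S.comul ∘ₗ V.subtype }, ?_⟩
  apply BialgStr.ext
  · refine LinearMap.ext₂ fun e f => ?_
    have hm : S.mul e f = (B.mul (projA h e) (projA h f) : E) + S.mul (projV h e) (projA h f)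
        + S.mul (projA h e) (projV h f) + S.mul (projV h e) (projV h f) := by
      have hA := hS.map_mul (projA h e) (projA h f)
      simp only [Submodule.subtype_apply] at hA
      rw [hA]
      conv_lhs => rw [← coe_projA_add_coe_projV h e, ← coe_projA_add_coe_projV h f]
      simp only [map_add, LinearMap.add_apply]
      abel
    rw [hm, ← coe_projA_add_coe_projV h (S.mul (projV h e) (projA h f)),
      ← coe_projA_add_coe_projV h (S.mul (projA h e) (projV h f)),
      ← coe_projA_add_coe_projV h (S.mul (projV h e) (projV h f))]
    simp only [unifiedII, LinearMap.add_apply, LinearMap.compr₂_apply, LinearMap.compl₁₂_apply,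
      Submodule.subtype_apply, map_add]
    abel
  · refine LinearMap.ext fun e => ?_
    have hc : S.comul e = TensorProduct.map A.subtype A.subtype (B.comul (projA h e))
        + S.comul (projV h e) := by
      rw [← hS.map_comul, Submodule.subtype_apply, ← map_add, coe_projA_add_coe_projV]
    rw [hc, tensor_eq_sum_components h (S.comul (projV h e))]
    simp only [unifiedII, LinearMap.add_apply, LinearMap.comp_apply, Submodule.subtype_apply]
    abel

theorem exists_unified_eq {B : BialgStr K A} {h : IsCompl A V} {S : BialgStr K E}
    (hS : IsExtendingSystem B h S) : ∃ Ω : DatumI B h ⊕ DatumII B h, unified B h Ω = S := by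
  rcases hS.isHom with hi | hp
  · obtain ⟨Ω, rfl⟩ := exists_unifiedII_eq h hi
    exact ⟨.inr ⟨Ω, hS.isAlternativeBialgebra⟩, rfl⟩
  · obtain ⟨Ω, rfl⟩ := exists_unifiedI_eq hp
    exact ⟨.inl ⟨Ω, hS.isAlternativeBialgebra⟩, rfl⟩

/-! ### The map on equivalence classes -/

theorem datumEquiv_iff (B : BialgStr K A) (h : IsCompl A V) (Ω Ω' : DatumI B h ⊕ DatumII B h) :
    DatumEquiv B h Ω Ω' ↔ ∃ e : E ≃ₗ[K] E,
      (unified B h Ω).IsHom (unified B h Ω') e.toLinearMap ∧ ∀ a : A, e a = a := by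
  constructor
  · rintro ⟨r, s, hb, hh⟩
    exact ⟨LinearEquiv.ofBijective (phi h r s) hb, hh, phi_apply_left h r s⟩
  · rintro ⟨e, he, ha⟩
    obtain ⟨r, s, hrs⟩ := exists_eq_phi h e.toLinearMap ha
    exact ⟨r, s, hrs ▸ e.bijective, hrs ▸ he⟩

/-- The map `HLB(V, A) → BExtd(E, A)` that sends the class of a datum to the class of its unified
bialgebra. -/
def upsilon (B : BialgStr K A) (h : IsCompl A V) : HLB B h → BExtd B h :=
  Quotient.map (fun Ω => ⟨unified B h Ω, unified_isExtendingSystem B h Ω⟩)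
    fun Ω Ω' hΩ => (datumEquiv_iff B h Ω Ω').1 hΩ

theorem upsilon_bijective (B : BialgStr K A) (h : IsCompl A V) :
    Function.Bijective (upsilon B h) := by
  constructor
  · rintro ⟨Ω⟩ ⟨Ω'⟩ hΩ
    exact Quotient.sound ((datumEquiv_iff B h Ω Ω').2 (Quotient.exact hΩ))
  · rintro ⟨S, hS⟩
    obtain ⟨Ω, rfl⟩ := exists_unified_eq hS
    exact ⟨Quotient.mk _ Ω, rfl⟩

end UnifiedStructures

end AltExt

end

theorem mainTheorem2 {K : Type*} [Field K] [CharZero K] {E : Type*} [AddCommGroup E] [Module K E]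
    (A V : Submodule K E) (h : IsCompl A V) (B : AltExt.AltBialgebra K A) :
    ∃ Υ : AltExt.HLB B.1 h → AltExt.BExtd B.1 h,
      (∀ Ω : AltExt.DatumI B.1 h,
        ∃ hΩ : AltExt.IsExtendingSystem B.1 h (AltExt.unifiedI B.1 h Ω.1),
          Υ (Quotient.mk (AltExt.datumSetoid B.1 h) (Sum.inl Ω)) =
            Quotient.mk (AltExt.extSetoid B.1 h) ⟨AltExt.unifiedI B.1 h Ω.1, hΩ⟩) ∧
      (∀ Ω : AltExt.DatumII B.1 h,
        ∃ hΩ : AltExt.IsExtendingSystem B.1 h (AltExt.unifiedII B.1 h Ω.1),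
          Υ (Quotient.mk (AltExt.datumSetoid B.1 h) (Sum.inr Ω)) =
            Quotient.mk (AltExt.extSetoid B.1 h) ⟨AltExt.unifiedII B.1 h Ω.1, hΩ⟩) ∧
      Function.Bijective Υ := by
  exact ⟨AltExt.upsilon B.1 h,
    fun Ω => ⟨AltExt.unified_isExtendingSystem B.1 h (.inl Ω), rfl⟩,
    fun Ω => ⟨AltExt.unified_isExtendingSystem B.1 h (.inr Ω), rfl⟩,
    AltExt.upsilon_bijective B.1 h⟩
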